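/- Let $n,l\ge 1$ be integers and consider words over a linearly ordered alphabet of $l$ letters. For words $u,v$ write $u\succ v$ if neither is a prefix of the other and, at the first position where they differ, the letter of $u$ is greater than that of $v$. A word $W$ is $n$-divisible if $W=vu_1u_2\cdots u_n$ for some word $v$ (possibly empty) and non-empty words $u_1,\dots,u_n$ with $u_1\succ u_2\succ\cdots\succ u_n$. The height of a set $M$ of words over a set $Y$ of words is the least integer $h\ge 0$ such that every word of $M$ has the form $y_1^{k_1}y_2^{k_2}\cdots y_r^{k_r}$ with $r\le h$, $y_i\in Y$ and integers $k_i\ge 0$. Put $$\Phi(n,l)=E_1\, l\, n^{E_2+12\log_3 n},\qquad E_1=4^{21\log_3 4+17},\qquad E_2=30\log_3 4+10 .$$ Then the height of the set of words that are not $n$-divisible over the set of words of length less than $n$ exists and is at most $\Phi(n,l)$. Moreover: (a) $\Phi(n,l)<2^{87}\, l\, n^{12\log_3 n+48}$ for all $n,l\ge 1$. (b) For every fixed $l\ge 1$, $2^{87}\, l\, n^{12\log_3 n+48}=n^{12(1+o(1))\log_3 n}$ as $n\to\infty$; in particular this bound is subexponential in $n$, that is, it is $o(c^n)$ for every real $c>1$.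 (c) For every fixed $n\ge 1$ there is a constant $C(n)>0$ with $\Phi(n,l)<C(n)\, l$ for all $l\ge 1$. -/

import Mathlib

namespace ShirshovHeight

/-- Words over the alphabet `α` are lists. `LexGreater u v` is `u ≻ v`: at the first position where
the words differ, the letter of `u` is the greater one. Words one of which is a beginning of the
other are incomparable. -/
def LexGreater {α : Type*} [LinearOrder α] (u v : List α) : Prop :=
  ∃ (p : List α) (a b : α) (s t : List α), u = p ++ a :: s ∧ v = p ++ b :: t ∧ b < a

/-- `W` is `n`-divisible: `W = v u₁ u₂ ⋯ uₙ` with non-empty `uᵢ` and `u₁ ≻ u₂ ≻ ⋯ ≻ uₙ`. -/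
def IsDivisible {α : Type*} [LinearOrder α] (n : ℕ) (W : List α) : Prop :=
  ∃ (v : List α) (us : List (List α)), us.length = n ∧ (∀ u ∈ us, u ≠ []) ∧
    us.IsChain LexGreater ∧ W = v ++ us.flatten

/-- The power `u ^ k` of a word. -/
def wordPow {α : Type*} (u : List α) (k : ℕ) : List α := (List.replicate k u).flatten

/-- Every word of `M` is a product `u₁ ^ k₁ ⋯ uᵣ ^ kᵣ` with `r ≤ h` and all `uᵢ` in `Y`. -/
def HeightAtMost {α : Type*} (M Y : Set (List α)) (h : ℕ) : Prop :=
  ∀ w ∈ M, ∃ L : List (List α × ℕ), L.length ≤ h ∧ (∀ q ∈ L, q.1 ∈ Y) ∧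
    w = (L.map fun q => wordPow q.1 q.2).flatten

/-- `h` is the height of the set of words `M` over the set of words `Y`. -/
def IsHeight {α : Type*} (M Y : Set (List α)) (h : ℕ) : Prop :=
  IsLeast {k : ℕ | HeightAtMost M Y k} h

/-- `E₁ = 4 ^ (21 log₃ 4 + 17)`. -/
noncomputable def E₁ : ℝ := (4 : ℝ) ^ (21 * Real.logb 3 4 + 17)

/-- `E₂ = 30 log₃ 4 + 10`. -/
noncomputable def E₂ : ℝ := 30 * Real.logb 3 4 + 10

/-- `Φ(n, l) = E₁ l n ^ (E₂ + 12 log₃ n)`. -/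
noncomputable def Phi (n l : ℕ) : ℝ := E₁ * (l : ℝ) * (n : ℝ) ^ (E₂ + 12 * Real.logb 3 (n : ℝ))

/-- The coarsened bound `2 ^ 87 l n ^ (12 log₃ n + 48)`. -/
noncomputable def coarsePhi (n l : ℕ) : ℝ :=
  (2 : ℝ) ^ 87 * (l : ℝ) * (n : ℝ) ^ (12 * Real.logb 3 (n : ℝ) + 48)

end ShirshovHeight

/-! Let `K = 2 ^ r` with `4 * n ≤ K`, and call a window aperiodic if the tails from its first `n`
offsets differ pairwise inside it. A window that is not aperiodic is a product of three powers of
words shorter than `n` (`isPowerProduct_of_not_aperiodic`), and where a long periodic run breaks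
there is an aperiodic window (`aperiodic_of_run_end`). So the height is, up to small terms, four
times the number of aperiodic windows of length `K` (`isPowerProduct_drop`).

To count these in a word that is not `n`-divisible, two configurations are excluded: `n` disjoint
copies of an aperiodic word (`seqDivisible_of_repeated`), and a chain of `p = 2 * n ^ 2 * K`
descents of tails at positions near aperiodic windows (`seqDivisible_of_chain`). The latter gives a
colouring of these positions in `p` colours with tails nondecreasing on each colour
(`exists_coloring`). By convexity of the lexicographic order, equal factors then fill an interval of
their colour. Hence doubling the factor length multiplies the number of coloured factors by at most
`3 * p ^ 2` instead of squaring it (`card_label_double`). After `r` doublings, each coloured factor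
accounts for at most `n * K` aperiodic windows. Since `r` is about `log₂ n`, the total is `n ^ O(log
n)` times the alphabet size. -/

namespace ShirshovHeight

/-! ### Aperiodic windows and sufficient conditions for divisibility. -/

section Sequences

variable {β : Type*}

/-- The `n` tails of the window `[s, s + m)` at the offsets `0, …, n - 1` pairwise differ
inside the window. -/
def Aperiodic (f : ℕ → β) (n s m : ℕ) : Prop :=
  ∀ i j, i < j → j < n → ∃ d, j + d < m ∧ f (s + i + d) ≠ f (s + j + d)

theorem Aperiodic.congr {f : ℕ → β} {n s s' m : ℕ} (h : Aperiodic f n s m)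
    (hs : ∀ e < m, f (s + e) = f (s' + e)) : Aperiodic f n s' m := by
  intro i j hij hj
  obtain ⟨d, hd, hne⟩ := h i j hij hj
  refine ⟨d, hd, ?_⟩
  rwa [add_assoc, add_assoc, ← hs _ (by omega), ← hs _ (by omega), ← add_assoc, ← add_assoc]

theorem Aperiodic.mono {f : ℕ → β} {n s m m' : ℕ} (h : Aperiodic f n s m) (hm : m ≤ m') :
    Aperiodic f n s m' := by
  intro i j hij hj
  obtain ⟨d, hd, hne⟩ := h i j hij hj
  exact ⟨d, by omega, hne⟩

theorem Aperiodic.of_shift {f : ℕ → β} {n s t m : ℕ} (h : Aperiodic f n (s + t) m) :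
    Aperiodic f n s (m + t) := by
  intro i j hij hj
  obtain ⟨d, hd, hne⟩ := h i j hij hj
  refine ⟨d + t, by omega, ?_⟩
  rwa [show s + i + (d + t) = s + t + i + d by omega,
    show s + j + (d + t) = s + t + j + d by omega]

theorem Aperiodic.lt_length {f : ℕ → β} {n s m : ℕ} (h : Aperiodic f n s m) (hn : 2 ≤ n) :
    n - 1 < m := by
  obtain ⟨d, hd, -⟩ := h 0 (n - 1) (by omega) (by omega)
  omega

/-- An aperiodic window of length `K` inside the beginning of length `N` starts at `s`. -/
def IsAperiodicAt (f : ℕ → β) (n K N s : ℕ) : Prop := Aperiodic f n s K ∧ s + K ≤ N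

/-- The position `s` is at most `j` after the start of an aperiodic window of length `K`. -/
def IsNear (f : ℕ → β) (n K N j s : ℕ) : Prop :=
  ∃ e, IsAperiodicAt f n K N e ∧ e ≤ s ∧ s ≤ e + j

variable [LinearOrder β]

/-- The tails of `f` at `s` and `s'` first differ at distance `d`, where the former is greater. -/
def LexDrop (f : ℕ → β) (s s' d : ℕ) : Prop :=
  (∀ e < d, f (s + e) = f (s' + e)) ∧ f (s' + d) < f (s + d)

/-- The tail of the sequence `f` at `s`, ordered lexicographically. -/
def tail (f : ℕ → β) (s : ℕ) : Lex (ℕ → β) := toLex fun d => f (s + d)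

/-- Cut points exhibiting the beginning of length `N` of `f` as an `n`-divisible word. -/
def SeqDivisible (f : ℕ → β) (n N : ℕ) : Prop :=
  ∃ q : ℕ → ℕ, q n = N ∧ (∀ i < n, q i < q (i + 1)) ∧
    ∀ i, i + 1 < n → ∃ d, q i + d < q (i + 1) ∧ q (i + 1) + d < q (i + 2) ∧
      LexDrop f (q i) (q (i + 1)) d

theorem tail_lt_tail {f : ℕ → β} {s s' : ℕ} :
    tail f s' < tail f s ↔ ∃ d, LexDrop f s s' d := by
  constructor
  · rintro ⟨d, h1, h2⟩
    exact ⟨d, fun e he => (h1 e he).symm, h2⟩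
  · rintro ⟨d, h1, h2⟩
    exact ⟨d, fun e he => (h1 e he).symm, h2⟩

/-- The sequences with a given beginning form a convex set in the lexicographic order. -/
theorem window_eq_of_tail_le {f : ℕ → β} {a b c m : ℕ} (hab : tail f a ≤ tail f b)
    (hbc : tail f b ≤ tail f c) (hac : ∀ e < m, f (a + e) = f (c + e)) :
    ∀ e < m, f (a + e) = f (b + e) := by
  by_contra! hcon
  classical
  have hex : ∃ e, e < m ∧ f (a + e) ≠ f (b + e) := hcon
  obtain ⟨hm, hne⟩ := Nat.find_spec hex
  set e := Nat.find hex
  have hlt : ∀ j < e, f (a + j) = f (b + j) := by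
    intro j hj
    by_contra hj'
    exact Nat.find_min hex hj ⟨by omega, hj'⟩
  rcases lt_or_gt_of_ne hne with h | h
  · refine absurd hbc (not_le.mpr (tail_lt_tail.mpr ⟨e, fun j hj => ?_, ?_⟩))
    · rw [← hlt j hj, hac j (by omega)]
    · rwa [← hac e hm]
  · exact absurd hab (not_le.mpr (tail_lt_tail.mpr ⟨e, hlt, h⟩))

/-- Gaps are harmless: each word is prolonged to the start of the next one, the last to `N`, and the
comparisons are already decided inside the shorter words. -/
theorem seqDivisible_of_disjoint {f : ℕ → β} {n N : ℕ} (x y : ℕ → ℕ)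
    (hxy : ∀ i < n, x i < y i) (hdisj : ∀ i, i + 1 < n → y i ≤ x (i + 1))
    (hN : ∀ i < n, y i ≤ N)
    (hlex : ∀ i, i + 1 < n → ∃ d, x i + d < y i ∧ x (i + 1) + d < y (i + 1) ∧
      LexDrop f (x i) (x (i + 1)) d) : SeqDivisible f n N := by
  have hstep : ∀ i < n, y i ≤ if i + 1 < n then x (i + 1) else N := by
    intro i hi
    split_ifs with h
    · exact hdisj i h
    · exact hN i hi
  refine ⟨fun i => if i < n then x i else N, by simp, fun i hi => ?_, fun i hi => ?_⟩
  · have := hstep i hi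
    have := hxy i hi
    simp only [hi, if_true]
    omega
  · obtain ⟨d, h1, h2, h3⟩ := hlex i hi
    have e0 : i < n := by omega
    have := hstep i e0
    have := hstep (i + 1) hi
    simp only [e0, hi, if_true, show i + 1 + 1 = i + 2 from rfl] at *
    exact ⟨d, by omega, by omega, h3⟩

/-- A sequence with `n` disjoint occurrences of an aperiodic word is `n`-divisible. -/
theorem seqDivisible_of_repeated {f : ℕ → β} {n N m : ℕ} (hn : 2 ≤ n) (z : ℕ → ℕ)
    (hap : Aperiodic f n (z 0) m) (heq : ∀ i < n, ∀ e < m, f (z i + e) = f (z 0 + e))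
    (hdisj : ∀ i, i + 1 < n → z i + m ≤ z (i + 1)) (hN : ∀ i < n, z i + m ≤ N) :
    SeqDivisible f n N := by
  have hm := hap.lt_length hn
  -- The cut in copy `i` is made at the `i`-th greatest tail of the repeated word; the dual order
  -- turns the sort into a decreasing one.
  let key : Fin n → (Lex (ℕ → β))ᵒᵈ := fun i => OrderDual.toDual (tail f (z 0 + i))
  have hdiff : ∀ i j : Fin n, i ≠ j →
      ∃ d, i + d < m ∧ j + d < m ∧ f (z 0 + i + d) ≠ f (z 0 + j + d) := by
    intro i j hij
    rcases lt_or_gt_of_ne hij with h | h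
    · obtain ⟨d, hd, hne⟩ := hap i j h j.2
      exact ⟨d, by have : (i : ℕ) < j := h
                   omega, hd, hne⟩
    · obtain ⟨d, hd, hne⟩ := hap j i h i.2
      exact ⟨d, hd, by have : (j : ℕ) < i := h
                       omega, hne.symm⟩
  have hsort := Tuple.monotone_sort key
  set σ := Tuple.sort key
  have hσ : ∀ i (hi : i + 1 < n), ∃ d,
      (σ ⟨i, by omega⟩ : ℕ) + d < m ∧ (σ ⟨i + 1, hi⟩ : ℕ) + d < m ∧
      LexDrop f (z 0 + σ ⟨i, by omega⟩) (z 0 + σ ⟨i + 1, hi⟩) d := by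
    intro i hi
    have hle : tail f (z 0 + σ ⟨i + 1, hi⟩) ≤ tail f (z 0 + σ ⟨i, by omega⟩) :=
      hsort (show (⟨i, by omega⟩ : Fin n) ≤ ⟨i + 1, hi⟩ from Nat.le_succ i)
    obtain ⟨d₀, h1, h2, h3⟩ := hdiff (σ ⟨i, by omega⟩) (σ ⟨i + 1, hi⟩) (by
      intro h
      have := σ.injective h
      simp at this)
    rcases hle.lt_or_eq with hlt | heq'
    · obtain ⟨d, hd⟩ := tail_lt_tail.mp hlt
      have : d ≤ d₀ := by
        by_contra hcon
        exact h3 (hd.1 d₀ (by omega))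
      exact ⟨d, by omega, by omega, hd⟩
    · exact absurd (congrFun (congrArg ofLex heq') d₀).symm h3
  refine seqDivisible_of_disjoint
    (fun i => z i + if h : i < n then (σ ⟨i, h⟩ : ℕ) else 0) (fun i => z i + m)
    (fun i hi => ?_) (fun i hi => ?_) hN (fun i hi => ?_)
  · have := (σ ⟨i, hi⟩).2
    simp only [hi, dif_pos]
    omega
  · have := hdisj i hi
    omega
  · obtain ⟨d, h1, h2, h3, h4⟩ := hσ i hi
    have hi' : i < n := by omega
    simp only [hi, hi', dif_pos]
    have tr : ∀ k < n, ∀ u e : ℕ, u + e < m → f (z k + u + e) = f (z 0 + u + e) := by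
      intro k hk u e hue
      rw [add_assoc, add_assoc]
      exact heq k hk _ hue
    refine ⟨d, by omega, by omega, fun e he => ?_, ?_⟩
    · rw [tr _ hi' _ _ (by omega), tr _ hi _ _ (by omega)]
      exact h3 e he
    · rw [tr _ hi' _ _ (by omega), tr _ hi _ _ (by omega)]
      exact h4

theorem add_le_of_step {g : ℕ → ℕ} {M : ℕ} (hg : ∀ i < M, g i < g (i + 1)) (a b : ℕ)
    (h : a + b ≤ M) : g a + b ≤ g (a + b) := by
  induction b with
  | zero => simp
  | succ b ih =>
    have := ih (by omega)
    have := hg (a + b) (by omega)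
    rw [show a + (b + 1) = a + b + 1 by ring]
    omega

theorem antitone_of_step {γ : Type*} [Preorder γ] {F : ℕ → γ} {M : ℕ}
    (hF : ∀ i < M, F (i + 1) < F i) (a b : ℕ) (h : a + b ≤ M) : F (a + b) ≤ F a := by
  induction b with
  | zero => simp
  | succ b ih => exact (hF (a + b) (by omega)).le.trans (ih (by omega))

theorem strictAnti_of_step {γ : Type*} [Preorder γ] {F : ℕ → γ} {M : ℕ}
    (hF : ∀ i < M, F (i + 1) < F i) (a b : ℕ) (hb : 0 < b) (h : a + b ≤ M) :
    F (a + b) < F a := by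
  obtain ⟨b, rfl⟩ := Nat.exists_eq_add_of_le' hb
  exact (hF (a + b) (by omega)).trans_le (antitone_of_step hF a b (by omega))

/-- Disjoint minimal aperiodic windows with decreasing tails give divisibility. -/
theorem seqDivisible_of_windows {f : ℕ → β} {n N : ℕ} (hn : 2 ≤ n) (x : ℕ → ℕ)
    (hx : ∀ i < n ^ 2, ∃ m, Aperiodic f n (x i) m ∧ x i + m ≤ x (i + 1))
    (hN : ∀ i ≤ n ^ 2, x i ≤ N) (ht : ∀ i < n ^ 2, tail f (x (i + 1)) < tail f (x i)) :
    SeqDivisible f n N := by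
  classical
  -- The least length of an aperiodic window at `x i`.
  let a : ℕ → ℕ := fun i => if h : ∃ m, Aperiodic f n (x i) m then Nat.find h else 0
  have ha : ∀ i < n ^ 2, Aperiodic f n (x i) (a i) := by
    intro i hi
    have h : ∃ m, Aperiodic f n (x i) m := (hx i hi).imp fun _ h => h.1
    simp only [a, h, dif_pos]
    exact Nat.find_spec h
  have hamin : ∀ i m, Aperiodic f n (x i) m → a i ≤ m := by
    intro i m hm
    have h : ∃ m, Aperiodic f n (x i) m := ⟨m, hm⟩
    simp only [a, h, dif_pos]
    exact Nat.find_min' h hm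
  have hxa : ∀ i < n ^ 2, x i + a i ≤ x (i + 1) := by
    intro i hi
    obtain ⟨m, h1, h2⟩ := hx i hi
    have := hamin i m h1
    omega
  have hstep : ∀ i < n ^ 2, x i < x (i + 1) := by
    intro i hi
    have := hxa i hi
    have := (ha i hi).lt_length hn
    omega
  by_contra hnd
  have hsq : n ^ 2 = (n - 1) * (n - 1) + 2 * (n - 1) + 1 := by
    obtain ⟨k, rfl⟩ := Nat.exists_eq_add_of_le' (show 1 ≤ n by omega)
    simp; ring
  -- Otherwise `n` consecutive positions, whose tails are squeezed between the first and the last,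
  -- carry disjoint copies of one aperiodic word.
  have hdiff : ∀ i, i + (n - 1) < n ^ 2 →
      ∃ d < a i, f (x i + d) ≠ f (x (i + (n - 1)) + d) := by
    intro i hi
    by_contra! hcon
    have hwin : ∀ j < n, ∀ e < a i, f (x (i + j) + e) = f (x i + e) := by
      intro j hj e he
      have h1 : tail f (x (i + (n - 1))) ≤ tail f (x (i + j)) := by
        have := antitone_of_step (F := fun i => tail f (x i)) ht (i + j) (n - 1 - j) (by omega)
        rwa [show i + j + (n - 1 - j) = i + (n - 1) by omega] at this
      have h2 : tail f (x (i + j)) ≤ tail f (x i) := antitone_of_step (F := fun i => tail f (x i)) ht i j (by omega)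
      rw [← window_eq_of_tail_le h1 h2 (fun e he => (hcon e he).symm) e he, hcon e he]
    refine hnd (seqDivisible_of_repeated hn (fun j => x (i + j)) (m := a i) (ha i (by omega))
      hwin (fun j hj => ?_) (fun j hj => ?_))
    all_goals
      have h1 : Aperiodic f n (x (i + j)) (a i) :=
        (ha i (by omega)).congr fun e he => (hwin j (by omega) e he).symm
      have h2 : a (i + j) ≤ a i := hamin _ _ h1
      have h3 : a i ≤ a (i + j) := hamin _ _ ((ha (i + j) (by omega)).congr fun e he =>
        hwin j (by omega) e (by omega))
      have h4 := hxa (i + j) (by omega)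
      have h5 := hN (i + j + 1) (by omega)
    · simp only [← add_assoc]
      omega
    · omega
  have hidx : ∀ j < n, j * (n - 1) ≤ (n - 1) * (n - 1) := fun j hj =>
    Nat.mul_le_mul_right _ (by omega)
  -- Every `(n - 1)`-st position: neighbours now differ inside the minimal window of the earlier
  -- one.
  refine hnd (seqDivisible_of_disjoint (fun j => x (j * (n - 1)))
    (fun j => x (j * (n - 1)) + a (j * (n - 1))) (fun j hj => ?_) (fun j hj => ?_)
    (fun j hj => ?_) (fun j hj => ?_))
  · have := hidx j hj
    have := (ha (j * (n - 1)) (by omega)).lt_length hn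
    omega
  · have := hidx j (by omega)
    have := hxa (j * (n - 1)) (by omega)
    have h := add_le_of_step hstep (j * (n - 1) + 1) (n - 2) (by omega)
    rw [show j * (n - 1) + 1 + (n - 2) = (j + 1) * (n - 1) by
      rw [add_mul]; omega] at h
    omega
  · have := hidx j hj
    have := hxa (j * (n - 1)) (by omega)
    have := hN (j * (n - 1) + 1) (by omega)
    omega
  · have := hidx j (by omega)
    have := hidx (j + 1) hj
    have e1 : (j + 1) * (n - 1) = j * (n - 1) + (n - 1) := by ring
    obtain ⟨d₀, hd₀, hne⟩ := hdiff (j * (n - 1)) (by omega)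
    rw [e1] at *
    obtain ⟨d, hd⟩ := tail_lt_tail.mp
      (strictAnti_of_step (F := fun i => tail f (x i)) ht (j * (n - 1)) (n - 1) (by omega) (by omega))
    have hdd : d ≤ d₀ := by
      by_contra hcon
      exact hne (hd.1 d₀ (by omega))
    refine ⟨d, by omega, ?_, hd⟩
    -- If the later minimal window ended before the difference, it would also be aperiodic at the
    -- earlier position, against minimality there.
    by_contra hcon
    have := hamin (j * (n - 1)) _ ((ha (j * (n - 1) + (n - 1)) (by omega)).congr fun e he =>
      (hd.1 e (by omega)).symm)
    omega

/-- A sequence with a long decreasing chain of tails near aperiodic windows is divisible. -/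
theorem seqDivisible_of_chain {f : ℕ → β} {n K N : ℕ} (hn : 2 ≤ n) (g : ℕ → ℕ)
    (hP : ∀ i ≤ n ^ 2 * (2 * K), IsNear f n K N K (g i))
    (hg : ∀ i < n ^ 2 * (2 * K), g i < g (i + 1))
    (ht : ∀ i < n ^ 2 * (2 * K), tail f (g (i + 1)) < tail f (g i)) (hK : 0 < K) :
    SeqDivisible f n N := by
  have hidx : ∀ i < n ^ 2, i * (2 * K) + 2 * K ≤ n ^ 2 * (2 * K) := by
    intro i hi
    calc i * (2 * K) + 2 * K = (i + 1) * (2 * K) := by ring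
      _ ≤ _ := Nat.mul_le_mul_right _ hi
  have e1 : ∀ i, (i + 1) * (2 * K) = i * (2 * K) + 2 * K := fun i => by ring
  refine seqDivisible_of_windows hn (fun i => g (i * (2 * K))) (fun i hi => ?_) (fun i hi => ?_)
    (fun i hi => ?_)
  · have := hidx i hi
    -- `K` steps of the chain advance at least `K` positions, so the window near the middle of a
    -- block of `2 * K` steps lies inside the block. Extending it leftwards to the start of the
    -- block keeps it aperiodic.
    obtain ⟨e, ⟨he, -⟩, h2, h3⟩ := hP (i * (2 * K) + K) (by omega)
    have h4 := add_le_of_step hg (i * (2 * K)) K (by omega)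
    have h5 := add_le_of_step hg (i * (2 * K) + K) K (by omega)
    refine ⟨K + (e - g (i * (2 * K))), ?_, ?_⟩
    · apply Aperiodic.of_shift
      rwa [show g (i * (2 * K)) + (e - g (i * (2 * K))) = e by omega]
    · simp only [e1]
      rw [show i * (2 * K) + 2 * K = i * (2 * K) + K + K by ring]
      omega
  · obtain ⟨e, ⟨-, h1⟩, h2, h3⟩ := hP (i * (2 * K)) (Nat.mul_le_mul_right _ hi)
    omega
  · simp only [e1]
    exact strictAnti_of_step (F := fun i => tail f (g i)) ht _ _ (by omega) (hidx i hi)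

end Sequences

/-! ### Colouring by chain length, and counting tools. -/

/-- Positions without long decreasing chains are coloured so that `F` is monotone on each
colour. -/
theorem exists_coloring {γ : Type*} [LinearOrder γ] (P : ℕ → Prop) (F : ℕ → γ) (p : ℕ)
    (hp : ¬ ∃ g : ℕ → ℕ, (∀ i ≤ p, P (g i)) ∧ (∀ i < p, g i < g (i + 1)) ∧
      ∀ i < p, F (g (i + 1)) < F (g i)) :
    ∃ c : ℕ → ℕ, (∀ s, P s → c s < p) ∧
      ∀ s s', P s → P s' → s < s' → c s = c s' → F s ≤ F s' := by
  classical
  -- The colour of `s` is the greatest number of descents in a chain ending at `s`. Positions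
  -- increase along a chain, so searching up to `s` loses nothing.
  let Q : ℕ → ℕ → Prop := fun s m => ∃ g : ℕ → ℕ, g m = s ∧ (∀ i ≤ m, P (g i)) ∧
    (∀ i < m, g i < g (i + 1)) ∧ ∀ i < m, F (g (i + 1)) < F (g i)
  have hQs : ∀ s m, Q s m → m ≤ s := by
    rintro s m ⟨g, rfl, -, h, -⟩
    have := add_le_of_step h 0 m (by omega)
    rw [Nat.zero_add] at this
    omega
  have hQp : ∀ s m, Q s m → m < p := by
    rintro s m ⟨g, -, h1, h2, h3⟩
    by_contra hcon
    exact hp ⟨g, fun i hi => h1 i (by omega), fun i hi => h2 i (by omega),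
      fun i hi => h3 i (by omega)⟩
  have hQ0 : ∀ s, P s → Q s 0 := fun s hs => ⟨fun _ => s, rfl, fun _ _ => hs, by simp, by simp⟩
  have hspec : ∀ s, P s → Q s (Nat.findGreatest (Q s) s) := fun s hs =>
    Nat.findGreatest_spec (P := Q s) (Nat.zero_le s) (hQ0 s hs)
  refine ⟨fun s => Nat.findGreatest (Q s) s, fun s hs => hQp s _ (hspec s hs), ?_⟩
  intro s s' hs hs' hss hc
  by_contra! hlt
  obtain ⟨g, h0, h1, h2, h3⟩ := hspec s hs
  set m := Nat.findGreatest (Q s) s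
  have hQ : Q s' (m + 1) := by
    refine ⟨fun i => if i ≤ m then g i else s', by simp, fun i hi => ?_, fun i hi => ?_,
      fun i hi => ?_⟩
    · by_cases h : i ≤ m
      · simpa [h] using h1 i h
      · simpa [h] using hs'
    · have hi' : i ≤ m := by omega
      by_cases h : i + 1 ≤ m
      · simpa [h, hi'] using h2 i h
      · obtain rfl : i = m := by omega
        simpa [h0] using hss
    · have hi' : i ≤ m := by omega
      by_cases h : i + 1 ≤ m
      · simpa [h, hi'] using h3 i h
      · obtain rfl : i = m := by omega
        simpa [h0] using hlt
  have := Nat.le_findGreatest (hQs _ _ hQ) hQ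
  simp only at hc
  omega

theorem card_image_le_card_image {ι γ δ : Type*} [Nonempty ι] [DecidableEq γ] [DecidableEq δ]
    (S : Finset ι) (φ : ι → γ) (ψ : ι → δ) (h : ∀ s ∈ S, ∀ s' ∈ S, φ s = φ s' → ψ s = ψ s') :
    (S.image ψ).card ≤ (S.image φ).card := by
  classical
  have hsec : ∀ u ∈ S.image ψ, ∃ s ∈ S, ψ s = u := fun u hu => Finset.mem_image.mp hu
  choose! r hr hψ using hsec
  refine Finset.card_le_card_of_injOn (fun u => φ (r u))
    (fun u hu => Finset.mem_image_of_mem φ (hr u hu)) fun u hu v hv huv => ?_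
  rw [← hψ u hu, ← hψ v hv]
  exact h _ (hr u hu) _ (hr v hv) huv

/-- A finite set with more than `n * K` elements has `n` elements at mutual distances at least
`K`. -/
theorem exists_separated (S : Finset ℕ) (n K : ℕ) (h : n * K < S.card) :
    ∃ z : ℕ → ℕ, (∀ i < n, z i ∈ S) ∧ ∀ i, i + 1 < n → z i + K ≤ z (i + 1) := by
  let g : ℕ → ℕ := fun i => if hi : i < S.card then S.orderEmbOfFin rfl ⟨i, hi⟩ else 0
  have hg : ∀ i < S.card - 1, g i < g (i + 1) := by
    intro i hi
    have h1 : i < S.card := by omega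
    have h2 : i + 1 < S.card := by omega
    simp only [g, h1, h2, dif_pos]
    exact (S.orderEmbOfFin rfl).strictMono (Nat.lt_succ_self i)
  have hidx : ∀ i < n, i * K + K ≤ S.card - 1 := by
    intro i hi
    have : (i + 1) * K ≤ n * K := Nat.mul_le_mul_right _ hi
    rw [add_mul] at this
    omega
  refine ⟨fun i => g (i * K), fun i hi => ?_, fun i hi => ?_⟩
  · have h1 : i * K < S.card := by
      have := hidx i hi
      omega
    simp only [g, h1, dif_pos]
    exact Finset.orderEmbOfFin_mem _ _ _
  · have := add_le_of_step hg (i * K) K (hidx i (by omega))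
    rwa [show i * K + K = (i + 1) * K by ring] at this

/-! ### Counting coloured factors by doubling their length. -/

section Labels

variable {β : Type*}

/-- The colour of a position together with the word of length `k` starting there. -/
def label (f : ℕ → β) (c : ℕ → ℕ) (k s : ℕ) : ℕ × (Fin k → β) := (c s, fun d => f (s + d))

theorem label_eq_iff {f : ℕ → β} {c : ℕ → ℕ} {k s s' : ℕ} :
    label f c k s = label f c k s' ↔ c s = c s' ∧ ∀ e < k, f (s + e) = f (s' + e) := by
  simp only [label, Prod.mk.injEq, funext_iff, Fin.forall_iff]

variable [LinearOrder β]

/-- The number of labels of length `k` at elements of `S` that are at most `s`. -/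
noncomputable def labelCount (f : ℕ → β) (c : ℕ → ℕ) (S : Finset ℕ) (k s : ℕ) : ℕ :=
  ((S.filter (· ≤ s)).image (label f c k)).card

theorem labelCount_mono (f : ℕ → β) (c : ℕ → ℕ) (S : Finset ℕ) (k : ℕ) :
    Monotone (labelCount f c S k) := by
  intro s s' h
  apply Finset.card_le_card
  apply Finset.image_subset_image
  intro x
  simp only [Finset.mem_filter]
  exact fun hx => ⟨hx.1, hx.2.trans h⟩

theorem labelCount_le (f : ℕ → β) (c : ℕ → ℕ) (S : Finset ℕ) (k s : ℕ) :
    labelCount f c S k s ≤ (S.image (label f c k)).card :=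
  Finset.card_le_card (Finset.image_subset_image (Finset.filter_subset _ _))

variable {f : ℕ → β} {c : ℕ → ℕ} {S : Finset ℕ} {k : ℕ}

/-- Positions of one colour between which no new label appears carry the same label. -/
theorem label_eq_of_labelCount_eq
    (hmono : ∀ s ∈ S, ∀ s' ∈ S, s ≤ s' → c s = c s' → tail f s ≤ tail f s') {s s' : ℕ}
    (hs : s ∈ S) (hs' : s' ∈ S) (hle : s ≤ s') (hc : c s = c s')
    (hcount : labelCount f c S k s = labelCount f c S k s') :
    label f c k s = label f c k s' := by
  have hsub : (S.filter (· ≤ s)).image (label f c k) ⊆ (S.filter (· ≤ s')).image (label f c k) := by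
    apply Finset.image_subset_image
    intro x
    simp only [Finset.mem_filter]
    exact fun hx => ⟨hx.1, hx.2.trans hle⟩
  have heq := Finset.eq_of_subset_of_card_le hsub hcount.ge
  have hmem : label f c k s' ∈ (S.filter (· ≤ s')).image (label f c k) :=
    Finset.mem_image_of_mem _ (by simp [hs'])
  rw [← heq, Finset.mem_image] at hmem
  obtain ⟨u, hu, hlab⟩ := hmem
  rw [Finset.mem_filter] at hu
  obtain ⟨h1, h2⟩ := label_eq_iff.mp hlab
  -- The label of `s'` already occurred at some `u ≤ s` of the same colour, and the tail at `s` lies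
  -- between those at `u` and `s'`.
  have hwin := window_eq_of_tail_le (hmono u hu.1 s hs hu.2 (h1.trans hc.symm))
    (hmono s hs s' hs' hle hc) h2
  rw [← hlab]
  exact label_eq_iff.mpr ⟨hc.trans h1.symm, fun e he => (hwin e he).symm⟩

/-- The label counts at `s` and `s + k` are both monotone in `s`, so equality of their sums forces
equality of each. The sum takes only `2 * D + 1` values, where the pair of counts could take
quadratically many; with the two colours it determines both halves of the factor. -/
theorem card_label_double {S' : Finset ℕ} {p : ℕ} (hS : ∀ s ∈ S', s ∈ S ∧ s + k ∈ S)
    (hc : ∀ s ∈ S, c s < p)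
    (hmono : ∀ s ∈ S, ∀ s' ∈ S, s ≤ s' → c s = c s' → tail f s ≤ tail f s') :
    (S'.image (label f c (2 * k))).card ≤ (2 * (S.image (label f c k)).card + 1) * p ^ 2 := by
  set D := (S.image (label f c k)).card
  let φ : ℕ → ℕ × ℕ × ℕ := fun s =>
    (labelCount f c S k s + labelCount f c S k (s + k), c s, c (s + k))
  have key : ∀ s ∈ S', ∀ s' ∈ S', s ≤ s' → φ s = φ s' →
      label f c (2 * k) s = label f c (2 * k) s' := by
    intro s hs s' hs' hle h
    simp only [φ, Prod.mk.injEq] at h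
    obtain ⟨h1, h2, h3⟩ := h
    have m1 := labelCount_mono f c S k hle
    have m2 := labelCount_mono f c S k (Nat.add_le_add_right hle k)
    have l1 := (label_eq_iff.mp (label_eq_of_labelCount_eq (k := k) hmono (hS s hs).1
      (hS s' hs').1 hle h2 (by omega))).2
    have l2 := (label_eq_iff.mp (label_eq_of_labelCount_eq (k := k) hmono (hS s hs).2 (hS s' hs').2
      (Nat.add_le_add_right hle k) h3 (by omega))).2
    refine label_eq_iff.mpr ⟨h2, fun e he => ?_⟩
    by_cases hek : e < k
    · exact l1 e hek
    · have := l2 (e - k) (by omega)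
      rwa [show s + k + (e - k) = s + e by omega, show s' + k + (e - k) = s' + e by omega] at this
  calc (S'.image (label f c (2 * k))).card ≤ (S'.image φ).card := by
        refine card_image_le_card_image S' φ _ fun s hs s' hs' h => ?_
        rcases le_total s s' with hle | hle
        · exact key s hs s' hs' hle h
        · exact (key s' hs' s hs hle h.symm).symm
    _ ≤ (Finset.range (2 * D + 1) ×ˢ Finset.range p ×ˢ Finset.range p).card := by
        apply Finset.card_le_card
        intro x hx
        obtain ⟨s, hs, rfl⟩ := Finset.mem_image.mp hx
        have h1 := labelCount_le f c S k s
        have h2 := labelCount_le f c S k (s + k)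
        simp only [φ, Finset.mem_product, Finset.mem_range]
        exact ⟨by omega, hc _ (hS s hs).1, hc _ (hS s hs).2⟩
    _ = (2 * D + 1) * p ^ 2 := by
        simp only [Finset.card_product, Finset.card_range]
        ring

/-- Iterates the doubling from single letters, with `2 * D + 1 ≤ 3 * X` because the bound `X` is at
least one. -/
theorem card_label_le [Fintype β] (S : ℕ → Finset ℕ) (p : ℕ) (hp : 0 < p)
    (hS : ∀ k, ∀ s ∈ S (2 * k), s ∈ S k ∧ s + k ∈ S k) (hc : ∀ k, 1 ≤ k → ∀ s ∈ S k, c s < p)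
    (hmono : ∀ k, 1 ≤ k →
      ∀ s ∈ S k, ∀ s' ∈ S k, s ≤ s' → c s = c s' → tail f s ≤ tail f s') (r : ℕ) :
    ((S (2 ^ r)).image (label f c (2 ^ r))).card ≤
      (3 * p ^ 2) ^ r * (p * Fintype.card β) := by
  induction r with
  | zero =>
    calc _ ≤ (Finset.range p ×ˢ (Finset.univ : Finset (Fin 1 → β))).card := by
          apply Finset.card_le_card
          intro x hx
          obtain ⟨s, hs, rfl⟩ := Finset.mem_image.mp hx
          simp [label, hc _ le_rfl s hs]
      _ = _ := by simp
  | succ r ih =>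
    set X := (3 * p ^ 2) ^ r * (p * Fintype.card β)
    have hX : 1 ≤ X := by
      have : Nonempty β := ⟨f 0⟩
      have := Fintype.card_pos (α := β)
      exact Nat.succ_le_of_lt (by positivity)
    have h := card_label_double (f := f) (hS (2 ^ r)) (hc _ Nat.one_le_two_pow)
      (hmono _ Nat.one_le_two_pow)
    rw [pow_succ']
    calc _ ≤ (2 * ((S (2 ^ r)).image (label f c (2 ^ r))).card + 1) * p ^ 2 := h
      _ ≤ (3 * X) * p ^ 2 := Nat.mul_le_mul_right _ (by omega)
      _ = _ := by rw [pow_succ]; ring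

/-- Bound for the number of aperiodic windows of length `2 ^ r` in a sequence that is not
divisible. -/
theorem card_isAperiodicAt_le [Fintype β] {n N r : ℕ} (hn : 2 ≤ n) (hnd : ¬ SeqDivisible f n N)
    (A : Finset ℕ) (hA : ∀ s ∈ A, IsAperiodicAt f n (2 ^ r) N s) :
    A.card ≤ n * 2 ^ r * ((3 * (n ^ 2 * (2 * 2 ^ r)) ^ 2) ^ r *
      (n ^ 2 * (2 * 2 ^ r) * Fintype.card β)) := by
  classical
  set K := 2 ^ r with hK
  have hK0 : 0 < K := by positivity
  set p := n ^ 2 * (2 * K)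
  obtain ⟨c, hc, hmono⟩ := exists_coloring (IsNear f n K N K) (tail f) p (by
    rintro ⟨g, h1, h2, h3⟩
    exact hnd (seqDivisible_of_chain hn g h1 h2 h3 hK0))
  -- Positions whose factor of length `k` lies inside some aperiodic window of length `K`; halving
  -- such a factor leaves both halves inside.
  let S : ℕ → Finset ℕ := fun k =>
    (Finset.range (N + 1)).filter fun s => ∃ j, j + k ≤ K ∧ IsNear f n K N j s
  have hSnear : ∀ k, ∀ s ∈ S k, IsNear f n K N K s := by
    intro k s hs
    obtain ⟨-, j, hj, e, h1, h2, h3⟩ := Finset.mem_filter.mp hs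
    exact ⟨e, h1, h2, by omega⟩
  have hSN : ∀ j k s, 1 ≤ j → j + k ≤ K → IsNear f n K N k s → s ∈ S j := by
    rintro j k s hj1 hj hs
    refine Finset.mem_filter.mpr ⟨?_, k, by omega, hs⟩
    obtain ⟨e, ⟨-, h1⟩, h2, h3⟩ := hs
    rw [Finset.mem_range]
    omega
  have hD := card_label_le (f := f) (c := c) S p (by positivity)
    (fun k s hs => by
      obtain ⟨hsN, j, hj, e, h1, h2, h3⟩ := Finset.mem_filter.mp hs
      refine ⟨Finset.mem_filter.mpr ⟨hsN, j, by omega, e, h1, h2, h3⟩,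
        Finset.mem_filter.mpr ⟨?_, j + k, by omega, e, h1, by omega, by omega⟩⟩
      rw [Finset.mem_range]
      have := h1.2
      omega)
    (fun k _ s hs => hc s (hSnear k s hs))
    (fun k _ s hs s' hs' hle hcc => by
      rcases hle.eq_or_lt with rfl | hlt
      · exact le_rfl
      · exact hmono s s' (hSnear k s hs) (hSnear k s' hs') hlt hcc) r
  rw [← hK] at hD
  have hAS : A ⊆ S K := fun s hs => hSN K 0 s hK0 (by omega) ⟨s, hA s hs, le_rfl, le_rfl⟩
  -- A label occurring more than `n * K` times would have `n` disjoint occurrences.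
  refine (Finset.card_le_mul_card_image (f := label f c K) A (n * K) fun u _ => ?_).trans
    (Nat.mul_le_mul_left _ ((Finset.card_le_card (Finset.image_subset_image hAS)).trans hD))
  by_contra! hcon
  obtain ⟨z, hz, hsep⟩ := exists_separated _ n K hcon
  have hz' : ∀ i < n, z i ∈ A ∧ label f c K (z i) = u := fun i hi =>
    Finset.mem_filter.mp (hz i hi)
  refine hnd (seqDivisible_of_repeated hn z (hA _ (hz' 0 (by omega)).1).1 (fun i hi => ?_) hsep
    fun i hi => (hA _ (hz' i hi).1).2)
  exact (label_eq_iff.mp ((hz' i hi).2.trans (hz' 0 (by omega)).2.symm)).2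

end Labels

/-! ### From sequences back to words; periodic words as products of powers. -/

section Words

variable {α : Type*}

/-- The letters of `W`, continued by a letter greater than all others. -/
def letters (W : List α) (i : ℕ) : WithTop α := if h : i < W.length then (W[i] : WithTop α) else ⊤

theorem letters_of_lt {W : List α} {i : ℕ} (h : i < W.length) :
    letters W i = (W[i] : WithTop α) := by
  simp [letters, h]

theorem lexGreater_of_getElem [LinearOrder α] {u v : List α} {d : ℕ} (hu : d < u.length)
    (hv : d < v.length) (heq : ∀ e (he : e < d), u[e] = v[e]) (hlt : v[d] < u[d]) :
    LexGreater u v := by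
  refine ⟨u.take d, u[d], v[d], u.drop (d + 1), v.drop (d + 1), ?_, ?_, hlt⟩
  · simp
  · have : u.take d = v.take d := by
      apply List.ext_getElem
      · simp; omega
      · intro i h1 h2
        simp only [List.getElem_take]
        exact heq i (by simp at h1; omega)
    rw [this]
    simp

theorem isDivisible_of_seqDivisible [LinearOrder α] {W : List α} {n : ℕ}
    (h : SeqDivisible (letters W) n W.length) : IsDivisible n W := by
  obtain ⟨q, hqn, hq, hlex⟩ := h
  have hqle : ∀ i ≤ n, q i ≤ W.length := by
    intro i hi
    have := add_le_of_step hq i (n - i) (by omega)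
    rw [show i + (n - i) = n by omega, hqn] at this
    omega
  let u : ℕ → List α := fun i => (W.drop (q i)).take (q (i + 1) - q i)
  have hlen : ∀ i < n, (u i).length = q (i + 1) - q i := by
    intro i hi
    have := hqle (i + 1) hi
    simp only [u, List.length_take, List.length_drop]
    omega
  have hget : ∀ i < n, ∀ d (hd : d < (u i).length), ((u i)[d] : WithTop α) = letters W (q i + d) := by
    intro i hi d hd
    have h1 := hlen i hi
    have := hqle (i + 1) hi
    rw [letters_of_lt (by omega)]
    simp [u]
  have hflat : ∀ m ≤ n, W.take (q m) = W.take (q 0) ++ ((List.range m).map u).flatten := by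
    intro m
    induction m with
    | zero => simp
    | succ m ih =>
      intro hm
      have := hq m (by omega)
      rw [List.range_succ, List.map_append, List.flatten_append, ← List.append_assoc,
        ← ih (by omega)]
      conv_lhs => rw [show q (m + 1) = q m + (q (m + 1) - q m) by omega, List.take_add]
      simp [u]
  refine ⟨W.take (q 0), (List.range n).map u, by simp, ?_, ?_, ?_⟩
  · intro w hw
    obtain ⟨i, hi, rfl⟩ := List.mem_map.mp hw
    rw [List.mem_range] at hi
    have := hlen i hi
    have := hq i hi
    exact List.ne_nil_of_length_pos (by omega)
  · rw [List.isChain_iff_getElem]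
    intro i hi
    simp only [List.length_map, List.length_range] at hi
    simp only [List.getElem_map, List.getElem_range]
    obtain ⟨d, h1, h2, h3, h4⟩ := hlex i hi
    have l1 := hlen i (by omega)
    have l2 := hlen (i + 1) hi
    rw [show i + 1 + 1 = i + 2 from rfl] at l2
    refine lexGreater_of_getElem (d := d) (by omega) (by omega) (fun e he => ?_) ?_
    · have := h3 e he
      rw [← hget i (by omega) e (by omega), ← hget (i + 1) hi e (by omega)] at this
      exact WithTop.coe_injective this
    · rw [← hget i (by omega) d (by omega), ← hget (i + 1) hi d (by omega)] at h4
      exact WithTop.coe_lt_coe.mp h4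
  · rw [← hflat n le_rfl, hqn, List.take_length]

/-- `w` is a product of at most `h` powers of words of length less than `n`. -/
def IsPowerProduct (n h : ℕ) (w : List α) : Prop :=
  ∃ L : List (List α × ℕ), L.length ≤ h ∧ (∀ q ∈ L, q.1.length < n) ∧
    w = (L.map fun q => wordPow q.1 q.2).flatten

theorem IsPowerProduct.mono {n h h' : ℕ} {w : List α} (hw : IsPowerProduct n h w) (hh : h ≤ h') :
    IsPowerProduct n h' w := by
  obtain ⟨L, h1, h2, h3⟩ := hw
  exact ⟨L, h1.trans hh, h2, h3⟩

theorem IsPowerProduct.append {n h h' : ℕ} {w w' : List α} (hw : IsPowerProduct n h w)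
    (hw' : IsPowerProduct n h' w') : IsPowerProduct n (h + h') (w ++ w') := by
  obtain ⟨L, h1, h2, rfl⟩ := hw
  obtain ⟨L', h1', h2', rfl⟩ := hw'
  refine ⟨L ++ L', by simp; omega, fun q hq => ?_, by simp⟩
  rcases List.mem_append.mp hq with h | h
  exacts [h2 q h, h2' q h]

theorem isPowerProduct_nil (n : ℕ) : IsPowerProduct n 0 ([] : List α) := ⟨[], by simp⟩

theorem isPowerProduct_wordPow {n : ℕ} {w : List α} (hw : w.length < n) (k : ℕ) :
    IsPowerProduct n 1 (wordPow w k) :=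
  ⟨[(w, k)], by simp, by simpa using hw, by simp⟩

theorem isPowerProduct_short {n : ℕ} {w : List α} (hw : w.length < n) :
    IsPowerProduct n 1 w := by
  simpa [wordPow] using isPowerProduct_wordPow hw 1

theorem isPowerProduct_length {n : ℕ} (hn : 2 ≤ n) (w : List α) : IsPowerProduct n w.length w := by
  induction w with
  | nil => exact isPowerProduct_nil n
  | cons a w ih =>
    have h : IsPowerProduct n 1 [a] := isPowerProduct_short (by simp; omega)
    exact (h.append ih).mono (by simp; omega)

/-- A word with period `|y|` that begins like `y` is a power of `y` followed by a shorter word. -/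
theorem eq_wordPow_append_of_prefix {y : List α} (hy : y ≠ []) (V : List α) (h : V <+: y ++ V) :
    ∃ (k : ℕ) (r : List α), r.length < y.length ∧ V = wordPow y k ++ r := by
  induction hN : V.length using Nat.strong_induction_on generalizing V with
  | _ N ih =>
    have hypos := List.length_pos_of_ne_nil hy
    by_cases hV : V.length < y.length
    · exact ⟨0, V, hV, by simp [wordPow]⟩
    · obtain ⟨V', rfl⟩ := List.prefix_of_prefix_length_le (List.prefix_append y V) h (by omega)
      rw [List.prefix_append_right_inj] at h
      have hlen : V'.length < N := by
        rw [← hN, List.length_append]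
        omega
      obtain ⟨k, r, hr, hV'⟩ := ih _ hlen V' h rfl
      refine ⟨k + 1, r, hr, ?_⟩
      conv_lhs => rw [hV']
      simp [wordPow, List.replicate_succ]

/-- Two agreeing tails at offsets `i < j < n` give period `j - i` after the first `i` letters: a
short prefix, a power and a short remainder. -/
theorem isPowerProduct_of_not_aperiodic {W : List α} {n s m : ℕ}
    (h : ¬ Aperiodic (letters W) n s m) (hm : s + m ≤ W.length) :
    IsPowerProduct n 3 ((W.drop s).take m) := by
  simp only [Aperiodic, not_forall, not_exists, not_and, not_not] at h
  obtain ⟨i, j, hij, hj, hper⟩ := h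
  set V := (W.drop s).take m with hV
  have hVlen : V.length = m := by simp [hV]; omega
  have hx : IsPowerProduct n 1 (V.take i) := isPowerProduct_short (by simp; omega)
  have hsplit : V = V.take i ++ V.drop i := (List.take_append_drop i V).symm
  rw [hsplit]
  refine (hx.append (h' := 2) ?_).mono (by omega)
  by_cases hshort : m < j
  · exact (isPowerProduct_short (by simp; omega)).mono (by omega)
  · set y := (V.drop i).take (j - i) with hy
    have hylen : y.length = j - i := by simp [hy]; omega
    have hdrop : V.drop i = y ++ V.drop j := by
      conv_lhs => rw [← List.take_append_drop (j - i) (V.drop i)]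
      rw [List.drop_drop, show i + (j - i) = j by omega]
    have hpre : V.drop j <+: V.drop i := by
      rw [List.prefix_iff_getElem]
      refine ⟨by simp; omega, fun d hd => ?_⟩
      have hd' : j + d < m := by simp at hd; omega
      have := hper d hd'
      rw [letters_of_lt (by omega), letters_of_lt (by omega)] at this
      have := WithTop.coe_injective this
      simp only [hV, List.getElem_drop, List.getElem_take]
      simp only [← add_assoc]
      exact this.symm
    obtain ⟨k, r, hr, hk⟩ := eq_wordPow_append_of_prefix
      (List.ne_nil_of_length_pos (by omega) : y ≠ []) (V.drop i) (by
        conv_lhs => rw [hdrop]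
        rwa [List.prefix_append_right_inj])
    rw [hk]
    exact (isPowerProduct_wordPow (by omega) k).append (isPowerProduct_short (by omega))

end Words

/-! ### Periodic runs and the bound by the number of aperiodic windows. -/

section Runs

variable {β : Type*} {f : ℕ → β} {n : ℕ}

/-- The end of a long periodic run, together with the letter after it, is aperiodic. -/
theorem aperiodic_of_run_end {s m : ℕ} (hm : 3 * n ≤ m) (h : ¬ Aperiodic f n s m)
    (h' : Aperiodic f n s (m + 1)) : Aperiodic f n (s + (m + 1 - 2 * n)) (2 * n) := by
  simp only [Aperiodic, not_forall, not_exists, not_and, not_not] at h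
  obtain ⟨i, j, hij, hj, hper⟩ := h
  obtain ⟨d₀, hd₀, hne⟩ := h' i j hij hj
  have hd₀' : j + d₀ = m := by
    by_contra hcon
    exact hne (hper d₀ (by omega))
  intro i' j' hij' hj'
  by_contra! hcon
  apply hne
  have hp : ∀ x, s + j ≤ x → x < s + m → f (x - (j - i)) = f x := by
    intro x h1 h2
    have := hper (x - (s + j)) (by omega)
    rwa [show s + i + (x - (s + j)) = x - (j - i) by omega,
      show s + j + (x - (s + j)) = x by omega] at this
  have hq : ∀ x, s + (m + 1 - 2 * n) + j' ≤ x → x ≤ s + m → f (x - (j' - i')) = f x := by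
    intro x h1 h2
    have := hcon (x - (s + (m + 1 - 2 * n) + j')) (by omega)
    rwa [show s + (m + 1 - 2 * n) + i' + (x - (s + (m + 1 - 2 * n) + j')) = x - (j' - i') by omega,
      show s + (m + 1 - 2 * n) + j' + (x - (s + (m + 1 - 2 * n) + j')) = x by omega] at this
  -- With `q = j - i` the period broken at `s + m` and `q' = j' - i'` a supposed period of the end
  -- window, the last letter equals those at distances `q'`, then `q' + q`, then `q` before it, so
  -- `q` would not be broken.
  have e1 := hq (s + m) (by omega) le_rfl
  have e2 := hp (s + m - (j' - i')) (by omega) (by omega)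
  have e3 := hq (s + m - (j - i)) (by omega) (by omega)
  rw [show s + i + d₀ = s + m - (j - i) by omega, show s + j + d₀ = s + m by omega, ← e1, ← e2,
    ← e3]
  congr 1
  omega

end Runs

/-- Each aperiodic window pays for four factors: its first letter and the three factors of a
periodic run. The additive `3 + K` covers a last run and a remainder shorter than `K`, split into
letters. -/
theorem isPowerProduct_drop {α : Type*} {W : List α} {n K : ℕ} (hn : 2 ≤ n) (hK : 3 * n ≤ K)
    (A : Finset ℕ) (hA : ∀ s, IsAperiodicAt (letters W) n K W.length s → s ∈ A) (s : ℕ) :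
    IsPowerProduct n (4 * (A.filter (s ≤ ·)).card + 3 + K) (W.drop s) := by
  induction hN : W.length - s using Nat.strong_induction_on generalizing s with
  | _ N ih =>
    -- Splitting off the letter at `t` uses up one window; of its four factors, three are left for a
    -- run preceding `t`.
    have hletter : ∀ t, s ≤ t → IsAperiodicAt (letters W) n K W.length t →
        IsPowerProduct n (4 * (A.filter (s ≤ ·)).card + K) (W.drop t) := by
      intro t hst ht
      have htl : t < W.length := by
        have := ht.2
        omega
      have h1 := ih (W.length - (t + 1)) (by omega) (t + 1) rfl
      have hcard : (A.filter (t + 1 ≤ ·)).card + 1 ≤ (A.filter (s ≤ ·)).card := by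
        rw [← Finset.card_insert_of_notMem (a := t) (by simp)]
        apply Finset.card_le_card
        intro x hx
        rw [Finset.mem_insert, Finset.mem_filter] at hx
        rw [Finset.mem_filter]
        rcases hx with rfl | ⟨h1, h2⟩
        · exact ⟨hA _ ht, hst⟩
        · exact ⟨h1, by omega⟩
      rw [List.drop_eq_getElem_cons htl, ← List.singleton_append]
      exact ((isPowerProduct_short (by simp; omega)).append h1).mono (by omega)
    by_cases hend : W.length < s + K
    · exact (isPowerProduct_length hn _).mono (by simp; omega)
    by_cases hap : Aperiodic (letters W) n s K
    · exact (hletter s le_rfl ⟨hap, by omega⟩).mono (by omega)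
    by_cases hrest : Aperiodic (letters W) n s (W.length - s)
    · classical
      have hex : ∃ m, Aperiodic (letters W) n s m := ⟨_, hrest⟩
      have hspec := Nat.find_spec hex
      have hmin := fun m => Nat.find_min (m := m) hex
      have hle := Nat.find_min' hex hrest
      have hgt : K < Nat.find hex := by
        by_contra hcon
        exact hap (hspec.mono (by omega))
      set M := Nat.find hex
      obtain ⟨m, hm⟩ : ∃ m, M = m + 1 := ⟨M - 1, by omega⟩
      rw [hm] at hspec
      have hnot := hmin m (by omega)
      have hrun := aperiodic_of_run_end (by omega) hnot hspec
      set t := m + 1 - 2 * n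
      have hsplit : W.drop s = (W.drop s).take t ++ W.drop (s + t) := by
        rw [← List.drop_drop, List.take_append_drop]
      have hper : IsPowerProduct n 3 ((W.drop s).take t) :=
        isPowerProduct_of_not_aperiodic (fun h => hnot (h.mono (by omega))) (by omega)
      rw [hsplit]
      by_cases hend' : W.length < s + t + K
      · exact (hper.append (isPowerProduct_length hn _)).mono (by simp; omega)
      · exact (hper.append (hletter (s + t) (by omega) ⟨hrun.mono (by omega), by omega⟩)).mono
          (by omega)
    · have := isPowerProduct_of_not_aperiodic hrest (by omega)
      rw [List.take_of_length_le (by simp)] at this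
      exact this.mono (by omega)

/-- The height bound in terms of `K = 2 ^ r`. -/
theorem heightAtMost_of_le_two_pow {α : Type*} [Fintype α] [LinearOrder α] {n r : ℕ} (hn : 2 ≤ n)
    (hr : 3 * n ≤ 2 ^ r) :
    HeightAtMost {W : List α | ¬ IsDivisible n W} {u : List α | u.length < n}
      (4 * (n * 2 ^ r * ((3 * (n ^ 2 * (2 * 2 ^ r)) ^ 2) ^ r *
        (n ^ 2 * (2 * 2 ^ r) * (Fintype.card α + 1)))) + 3 + 2 ^ r) := by
  classical
  intro W hW
  have hnd : ¬ SeqDivisible (letters W) n W.length := fun h => hW (isDivisible_of_seqDivisible h)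
  let A := (Finset.range W.length).filter (IsAperiodicAt (letters W) n (2 ^ r) W.length)
  have hcard := card_isAperiodicAt_le hn hnd A fun s hs => (Finset.mem_filter.mp hs).2
  -- The letter continuing the word beyond its end enlarges the alphabet by one.
  rw [show Fintype.card (WithTop α) = Fintype.card α + 1 from Fintype.card_option] at hcard
  have h := isPowerProduct_drop hn hr A (fun s hs => Finset.mem_filter.mpr
    ⟨Finset.mem_range.mpr (by have := hs.2; omega), hs⟩) 0
  rw [List.drop_zero] at h
  have hle := Finset.card_filter_le A (0 ≤ ·)
  exact h.mono (by omega)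

/-! ### Estimates of `Phi` and `coarsePhi`. -/

open Filter Topology

theorem one_lt_log_three : 1 < Real.log 3 := by
  rw [Real.lt_log_iff_exp_lt (by norm_num)]
  linarith [Real.exp_one_lt_d9]

theorem logb_three_four_lower : (5 / 4 : ℝ) ≤ Real.logb 3 4 := by
  rw [Real.le_logb_iff_rpow_le (by norm_num) (by norm_num)]
  rw [← Real.rpow_le_rpow_iff (z := 4) (by positivity) (by norm_num) (by norm_num),
    ← Real.rpow_mul (by norm_num)]
  norm_num

/-- `53 / 42` is the value at which `21 * x + 17 = 87 / 2`, so that `E₁` stays below `4 ^ (87 / 2) =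
2 ^ 87`. -/
theorem logb_three_four_upper : Real.logb 3 4 < 53 / 42 := by
  rw [Real.logb_lt_iff_lt_rpow (by norm_num) (by norm_num)]
  rw [← Real.rpow_lt_rpow_iff (z := 42) (by norm_num) (by positivity) (by norm_num),
    ← Real.rpow_mul (by norm_num)]
  norm_num

theorem E₁_pos : 0 < E₁ := by unfold E₁; positivity

theorem E₁_lt : E₁ < 2 ^ 87 := by
  have h := logb_three_four_upper
  calc E₁ < (4 : ℝ) ^ (87 / 2 : ℝ) := Real.rpow_lt_rpow_of_exponent_lt (by norm_num) (by linarith)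
    _ = 2 ^ 87 := by
      rw [show (4 : ℝ) = 2 ^ (2 : ℝ) by norm_num, ← Real.rpow_mul (by norm_num)]
      norm_num

theorem le_E₁ : 2 ^ 80 ≤ E₁ := by
  have h := logb_three_four_lower
  calc (2 : ℝ) ^ 80 = (4 : ℝ) ^ (40 : ℝ) := by norm_num
    _ ≤ E₁ := Real.rpow_le_rpow_of_exponent_le (by norm_num) (by linarith)

theorem Phi_lt_coarsePhi {n l : ℕ} (hn : 1 ≤ n) (hl : 1 ≤ l) : Phi n l < coarsePhi n l := by
  have hn' : (1 : ℝ) ≤ n := by exact_mod_cast hn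
  have hl' : (0 : ℝ) < l := by exact_mod_cast hl
  have h := logb_three_four_upper
  have hE₂ : E₂ ≤ 48 := by unfold E₂; linarith
  unfold Phi coarsePhi
  calc E₁ * (l : ℝ) * (n : ℝ) ^ (E₂ + 12 * Real.logb 3 (n : ℝ))
      ≤ E₁ * (l : ℝ) * (n : ℝ) ^ (12 * Real.logb 3 (n : ℝ) + 48) := by
        have := E₁_pos
        gcongr ?_ * ?_
        exact Real.rpow_le_rpow_of_exponent_le hn' (by linarith)
    _ < _ := by
        have := E₁_lt
        gcongr

theorem coarsePhi_eq_exp {n l : ℕ} (hn : 1 ≤ n) (hl : 1 ≤ l) :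
    coarsePhi n l = Real.exp (Real.log (2 ^ 87 * l) +
      Real.log n * (12 * Real.logb 3 n + 48)) := by
  have hn' : (0 : ℝ) < n := by exact_mod_cast hn
  have hl' : (0 : ℝ) < l := by exact_mod_cast hl
  unfold coarsePhi
  rw [Real.exp_add, Real.exp_log (by positivity), Real.rpow_def_of_pos hn']

theorem tendsto_log_natCast : Tendsto (fun n : ℕ => Real.log n) atTop atTop :=
  Real.tendsto_log_atTop.comp tendsto_natCast_atTop_atTop

theorem coarsePhi_eq_rpow {l : ℕ} (hl : 1 ≤ l) :
    ∃ ε : ℕ → ℝ, Tendsto ε atTop (𝓝 0) ∧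
      ∀ᶠ n : ℕ in atTop,
        coarsePhi n l = (n : ℝ) ^ (12 * (1 + ε n) * Real.logb 3 (n : ℝ)) := by
  set C := Real.log (2 ^ 87 * l)
  have hlog3 : 0 < Real.log 3 := by linarith [one_lt_log_three]
  -- Solves `C + 48 * log n = 12 * ε * log₃ n * log n` for `ε`.
  refine ⟨fun n => (C / Real.log n + 48) * (Real.log 3 / 12) / Real.log n, ?_, ?_⟩
  · have h1 : Tendsto (fun n : ℕ => (C / Real.log n + 48) * (Real.log 3 / 12)) atTop
        (𝓝 ((0 + 48) * (Real.log 3 / 12))) :=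
      ((tendsto_log_natCast.const_div_atTop C).add_const 48).mul_const _
    exact h1.div_atTop tendsto_log_natCast
  · filter_upwards [eventually_ge_atTop 2] with n hn
    have hn' : (0 : ℝ) < n := by positivity
    have hlog : 0 < Real.log n := Real.log_pos (by exact_mod_cast hn)
    rw [coarsePhi_eq_exp (by omega) hl, Real.rpow_def_of_pos hn']
    congr 1
    unfold Real.logb
    field_simp
    ring

/-- The exponents of the two exponentials differ by `n * (log c - o(1))`, since `(log n) ^ 2 / n`
tends to zero. -/
theorem coarsePhi_isLittleO {l : ℕ} (hl : 1 ≤ l) {c : ℝ} (hc : 1 < c) :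
    Asymptotics.IsLittleO atTop (fun n : ℕ => coarsePhi n l) (fun n : ℕ => c ^ n) := by
  have hlogc := Real.log_pos hc
  have hc0 : 0 < c := by linarith
  set C := Real.log (2 ^ 87 * l)
  have hrw : (fun n : ℕ => c ^ n) = fun n : ℕ => Real.exp (n * Real.log c) := by
    funext n
    rw [← Real.log_pow, Real.exp_log (by positivity)]
  have hev : (fun n : ℕ => coarsePhi n l) =ᶠ[atTop]
      fun n : ℕ => Real.exp (C + Real.log n * (12 * Real.logb 3 n + 48)) := by
    filter_upwards [eventually_ge_atTop 1] with n hn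
    exact coarsePhi_eq_exp hn hl
  rw [hrw]
  refine hev.trans_isLittleO ?_
  rw [Real.isLittleO_exp_comp_exp_comp]
  have hlog2 : Tendsto (fun n : ℕ => Real.log n ^ 2 / n) atTop (𝓝 0) :=
    ((Real.isLittleO_pow_log_id_atTop (n := 2)).tendsto_div_nhds_zero).comp tendsto_natCast_atTop_atTop
  have hlog1 : Tendsto (fun n : ℕ => Real.log n / n) atTop (𝓝 0) :=
    (Real.isLittleO_log_id_atTop.tendsto_div_nhds_zero).comp tendsto_natCast_atTop_atTop
  have hlim : Tendsto (fun n : ℕ => Real.log c - (C / n + 12 / Real.log 3 * (Real.log n ^ 2 / n) +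
      48 * (Real.log n / n))) atTop (𝓝 (Real.log c - (0 + 12 / Real.log 3 * 0 + 48 * 0))) :=
    tendsto_const_nhds.sub (((tendsto_natCast_atTop_atTop.const_div_atTop C).add
      (hlog2.const_mul _)).add (hlog1.const_mul _))
  have hmul := Tendsto.atTop_mul_pos (by linarith) tendsto_natCast_atTop_atTop hlim
  refine hmul.congr' ?_
  filter_upwards [eventually_ge_atTop 1] with n hn
  have hn' : (0 : ℝ) < n := by exact_mod_cast hn
  have hlog3 : 0 < Real.log 3 := by linarith [one_lt_log_three]
  unfold Real.logb
  field_simp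
  ring

theorem Phi_lt_const_mul (n : ℕ) :
    ∃ C : ℝ, 0 < C ∧ ∀ l : ℕ, 1 ≤ l → Phi n l < C * (l : ℝ) := by
  have hE := E₁_pos
  refine ⟨E₁ * (n : ℝ) ^ (E₂ + 12 * Real.logb 3 (n : ℝ)) + 1, by positivity, fun l hl => ?_⟩
  have hl' : (0 : ℝ) < l := by exact_mod_cast hl
  unfold Phi
  nlinarith

/-! ### Comparison of the combinatorial bound with `Phi`. -/

/-- From `4 * n ≤ K` follows `8 * p ≤ K ^ 3`, so each doubling costs at most `K ^ 6 = 2 ^ (6 * r)`.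
-/
theorem height_bound_le_two_pow {n r l : ℕ} (hr : 4 * n ≤ 2 ^ r) (hl : 1 ≤ l) :
    4 * (n * 2 ^ r * ((3 * (n ^ 2 * (2 * 2 ^ r)) ^ 2) ^ r * (n ^ 2 * (2 * 2 ^ r) * (l + 1)))) +
      3 + 2 ^ r ≤ 2 ^ (6 * r ^ 2 + 5 * r + 4) * l := by
  set K := 2 ^ r with hK
  have hK1 : 1 ≤ K := Nat.one_le_two_pow
  have hp : n ^ 2 * (2 * K) * 8 ≤ K ^ 3 := by
    calc n ^ 2 * (2 * K) * 8 = (4 * n) ^ 2 * K := by ring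
      _ ≤ K ^ 2 * K := by gcongr
      _ = K ^ 3 := by ring
  set p := n ^ 2 * (2 * K)
  have hstep : 3 * p ^ 2 ≤ K ^ 6 := by
    calc 3 * p ^ 2 ≤ (p * 8) ^ 2 := by nlinarith
      _ ≤ (K ^ 3) ^ 2 := by gcongr
      _ = K ^ 6 := by ring
  have hpow : (3 * p ^ 2) ^ r ≤ 2 ^ (6 * r ^ 2) := by
    calc (3 * p ^ 2) ^ r ≤ (K ^ 6) ^ r := by gcongr
      _ = 2 ^ (6 * r ^ 2) := by
        rw [hK, ← pow_mul, ← pow_mul]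
        congr 1
        ring
  have hX : 1 ≤ 2 ^ (6 * r ^ 2) := Nat.one_le_two_pow
  set X := 2 ^ (6 * r ^ 2)
  have hgoal : 2 ^ (6 * r ^ 2 + 5 * r + 4) * l = 16 * (X * K ^ 5 * l) := by
    rw [pow_add, pow_add, hK, ← pow_mul, mul_comm r 5]
    ring
  rw [hgoal]
  have h1 : n * K * ((3 * p ^ 2) ^ r * (p * (l + 1))) * 4 ≤ X * K ^ 5 * l * 4 := by
    calc n * K * ((3 * p ^ 2) ^ r * (p * (l + 1))) * 4
        ≤ K * K * (X * (p * (2 * l))) * 4 := by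
          gcongr
          · omega
          · omega
      _ = K * K * X * l * (p * 8) := by ring
      _ ≤ K * K * X * l * K ^ 3 := by gcongr
      _ = X * K ^ 5 * l := by ring
      _ ≤ X * K ^ 5 * l * 4 := by omega
  have h2 : K ≤ X * K ^ 5 * l := by
    calc K = 1 * K ^ 1 * 1 := by ring
      _ ≤ X * K ^ 5 * l := by gcongr; norm_num
  omega

/-- For `x = Nat.log 2 n` the exponent of two is `73 + x * (6 * x + 41)`; `E₁` absorbs `2 ^ 73`,
while `2 ^ x ≤ n` and `x ≤ 2 * log₃ n` handle the rest. -/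
theorem two_pow_mul_le_Phi {n l : ℕ} (hn : 1 ≤ n) :
    ((2 ^ (6 * (Nat.log 2 n + 3) ^ 2 + 5 * (Nat.log 2 n + 3) + 4) * l : ℕ) : ℝ) ≤ Phi n l := by
  have hn' : (1 : ℝ) ≤ n := by exact_mod_cast hn
  have hn0 : (0 : ℝ) < n := by linarith
  set x := Nat.log 2 n
  have hx : (2 : ℝ) ^ x ≤ n := by exact_mod_cast Nat.pow_log_le_self 2 (by omega)
  have hlog3 : 0 < Real.log 3 := by linarith [one_lt_log_three]
  have hlog2 : 0 < Real.log 2 := Real.log_pos (by norm_num)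
  have hlogx : x * Real.log 2 ≤ Real.log n := by
    rw [← Real.log_pow]
    exact Real.log_le_log (by positivity) hx
  have h34 : Real.log 3 ≤ 2 * Real.log 2 := by
    rw [show (2 : ℝ) * Real.log 2 = Real.log (2 ^ 2) by rw [Real.log_pow]; norm_num]
    exact Real.log_le_log (by norm_num) (by norm_num)
  have hexp : (6 * x + 41 : ℝ) ≤ E₂ + 12 * Real.logb 3 n := by
    have h := logb_three_four_lower
    have h2 : (x : ℝ) ≤ 2 * Real.logb 3 n := by
      unfold Real.logb
      rw [mul_div_assoc', le_div_iff₀ hlog3]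
      nlinarith [mul_le_mul_of_nonneg_left h34 (Nat.cast_nonneg (α := ℝ) x)]
    unfold E₂
    linarith
  have hE := le_E₁
  unfold Phi
  push_cast
  calc (2 : ℝ) ^ (6 * (x + 3) ^ 2 + 5 * (x + 3) + 4) * l
      = 2 ^ 73 * l * ((2 : ℝ) ^ x) ^ (6 * x + 41) := by
        rw [← pow_mul, show 6 * (x + 3) ^ 2 + 5 * (x + 3) + 4 = 73 + x * (6 * x + 41) by ring,
          pow_add]
        ring
    _ ≤ E₁ * l * (n : ℝ) ^ (6 * x + 41) := by
        gcongr
        exact le_trans (by norm_num) hE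
    _ ≤ E₁ * l * (n : ℝ) ^ (E₂ + 12 * Real.logb 3 n) := by
        have := E₁_pos
        gcongr
        rw [← Real.rpow_natCast]
        apply Real.rpow_le_rpow_of_exponent_le hn'
        push_cast
        exact hexp

theorem HeightAtMost.mono {α : Type*} {M Y : Set (List α)} {h h' : ℕ} (hM : HeightAtMost M Y h)
    (hh : h ≤ h') : HeightAtMost M Y h' := by
  intro w hw
  obtain ⟨L, h1, h2, h3⟩ := hM w hw
  exact ⟨L, h1.trans hh, h2, h3⟩

theorem heightAtMost_two_pow {α : Type*} [Fintype α] [LinearOrder α] {n l : ℕ} (hn : 1 ≤ n)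
    (hl : 1 ≤ l) (hcard : Fintype.card α = l) :
    HeightAtMost {W : List α | ¬ IsDivisible n W} {u : List α | u.length < n}
      (2 ^ (6 * (Nat.log 2 n + 3) ^ 2 + 5 * (Nat.log 2 n + 3) + 4) * l) := by
  have hr : 4 * n ≤ 2 ^ (Nat.log 2 n + 3) := by
    have := Nat.lt_pow_succ_log_self (b := 2) (by norm_num) n
    rw [Nat.succ_eq_add_one] at this
    rw [show Nat.log 2 n + 3 = Nat.log 2 n + 1 + 2 by ring, pow_add _ _ 2]
    omega
  rcases hn.eq_or_lt with rfl | hn2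
  -- For `n = 1` every non-empty word is divisible, so only the empty word remains.
  · intro W hW
    have hnil : W = [] := by
      by_contra hne
      exact hW ⟨[], [W], rfl, by simpa using hne, List.isChain_singleton W, by simp⟩
    exact ⟨[], by simp, by simp, by simp [hnil]⟩
  · generalize Nat.log 2 n + 3 = r at hr ⊢
    subst hcard
    exact (heightAtMost_of_le_two_pow hn2 (r := r) (by omega)).mono
      (height_bound_le_two_pow hr hl)

theorem exists_isHeight {α : Type*} [Fintype α] [LinearOrder α] {n l : ℕ} (hn : 1 ≤ n)
    (hl : 1 ≤ l) (hcard : Fintype.card α = l) :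
    ∃ h : ℕ, IsHeight {W : List α | ¬ IsDivisible n W} {u : List α | u.length < n} h ∧
      (h : ℝ) ≤ Phi n l := by
  classical
  have hbound := heightAtMost_two_pow hn hl hcard
  have hex : ∃ k, HeightAtMost {W : List α | ¬ IsDivisible n W} {u : List α | u.length < n} k :=
    ⟨_, hbound⟩
  refine ⟨Nat.find hex, ⟨Nat.find_spec hex, fun k hk => Nat.find_min' hex hk⟩, ?_⟩
  refine le_trans ?_ (two_pow_mul_le_Phi (l := l) hn)
  exact_mod_cast Nat.find_min' hex hbound

end ShirshovHeight

theorem theoremc :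
    -- the height exists and is at most `Φ(n, l)`
    (∀ n l : ℕ, 1 ≤ n → 1 ≤ l →
      ∀ (α : Type*) [Fintype α] [LinearOrder α], Fintype.card α = l →
        ∃ h : ℕ,
          ShirshovHeight.IsHeight {W : List α | ¬ ShirshovHeight.IsDivisible n W}
            {u : List α | u.length < n} h ∧
          (h : ℝ) ≤ ShirshovHeight.Phi n l) ∧
    -- the coarsened bound
    (∀ n l : ℕ, 1 ≤ n → 1 ≤ l → ShirshovHeight.Phi n l < ShirshovHeight.coarsePhi n l) ∧
    -- for fixed `l` the coarsened bound is `n ^ (12 (1 + o(1)) log₃ n)`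
    (∀ l : ℕ, 1 ≤ l → ∃ ε : ℕ → ℝ, Filter.Tendsto ε Filter.atTop (nhds 0) ∧
      ∀ᶠ n : ℕ in Filter.atTop,
        ShirshovHeight.coarsePhi n l = (n : ℝ) ^ (12 * (1 + ε n) * Real.logb 3 (n : ℝ))) ∧
    -- for fixed `l` the coarsened bound is subexponential in `n`
    (∀ l : ℕ, 1 ≤ l → ∀ c : ℝ, 1 < c →
      Asymptotics.IsLittleO Filter.atTop (fun n : ℕ => ShirshovHeight.coarsePhi n l)
        (fun n : ℕ => c ^ n)) ∧
    -- for fixed `n` the bound is linear in `l`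
    (∀ n : ℕ, 1 ≤ n → ∃ C : ℝ, 0 < C ∧ ∀ l : ℕ, 1 ≤ l →
      ShirshovHeight.Phi n l < C * (l : ℝ)) := by
  exact ⟨fun _ _ hn hl _ _ _ hcard => ShirshovHeight.exists_isHeight hn hl hcard,
    fun _ _ hn hl => ShirshovHeight.Phi_lt_coarsePhi hn hl,
    fun _ hl => ShirshovHeight.coarsePhi_eq_rpow hl,
    fun _ hl _ hc => ShirshovHeight.coarsePhi_isLittleO hl hc,
    fun n _ => ShirshovHeight.Phi_lt_const_mul n⟩
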